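/- Let $\Gamma$ be a countably infinite discrete group acting continuously on a compact metrizable space $X$. Naive entropy. For a finite open cover $\mathcal U$ of $X$ and a nonempty finite $F\subseteq\Gamma$, let $\mathcal U^F=\bigvee_{s\in F}s^{-1}\mathcal U$ be the cover consisting of the sets $\bigcap_{s\in F}s^{-1}U_s$ with $U_s\in\mathcal U$, and let $N(\cdot)$ denote the minimal cardinality of a subcover. The naive entropy of the action is $$h^{\mathrm{nv}}(\Gamma\curvearrowright X)=\sup_{\mathcal U}\inf_F\frac{1}{|F|}\log N(\mathcal U^F),$$ where $\mathcal U$ ranges over the finite open covers of $X$ and $F$ over the nonempty finite subsets of $\Gamma$. Independence. Let $\mathbf A=(A_1,\dots,A_k)$ be a $k$-tuple of subsets of $X$. A set $J\subseteq\Gamma$ is an independence set for $\mathbf A$ if $\bigcap_{s\in F}s^{-1}A_{\omega(s)}\neq\emptyset$ for every nonempty finite $F\subseteq J$ and every map $\omega:F\to\{1,\dots,k\}$. The independence density of a nonempty finite family $\mathcal A$ of tuples is the largest $q\ge 0$ such that every nonempty finite $F\subseteq\Gamma$ has a subset $J$ with $|J|\ge q|F|$ that is an independence set for some $\mathbf A\in\mathcal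 A$ (the empty family is assigned density $0$); the density of a single tuple $\mathbf A$ is that of $\{\mathbf A\}$. The family $\mathcal A$ is pairwise disjoint (closed) if, for each of its members $(A_1,\dots,A_k)$, the sets $A_1,\dots,A_k$ are pairwise disjoint (closed). A pair $(x,y)\in X^2$ is an orbit IE-pair if for all neighborhoods $U$ of $x$ and $V$ of $y$ the pair $(U,V)$ has positive independence density; it is non-diagonal if $x\ne y$. Let $F_2$ be the free group with free generators $a,b$, let $\mathbb ZF_2$ be its integral group ring, and let $X_{a-1}$ be the Pontryagin dual of the left $\mathbb ZF_2$-module $\mathbb ZF_2/\mathbb ZF_2(a-1)$, that is, the group of all homomorphisms from this module to $\mathbb R/\mathbb Z$ with the topology of pointwise convergence. Let $F_2$ act on it by $(s\varphi)(m)=\varphi(s^{-1}m)$. **Proposition.** $X_{a-1}$ is a compact metrizable abelian group, $F_2$ acts on it by continuous automorphisms, the action $F_2\curvearrowright X_{a-1}$ has positive naive entropy, and $X_{a-1}$ has no non-diagonal orbit IE-pairs. Furthermore, there is a finite, pairwise disjoint, closed family $\mathcal A$ of pairs of subsets of $X_{a-1}$ such that $\mathcal A$ has positive independence density but no $\mathbf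 A\in\mathcal A$ has positive independence density. -/

import Mathlib

open Topology

noncomputable section

/-! ### Combinatorial independence -/

section Independence

variable (Γ : Type*) {X : Type*} [Group Γ] [MulAction Γ X]

/-- `J ⊆ Γ` is an independence set for the `k`-tuple `A` of subsets of `X`: for every nonempty
finite `F ⊆ J` and every `ω : F → [k]`, the set `⋂_{s ∈ F} s⁻¹ A_{ω(s)}` is nonempty. -/
def IsIndependenceSet {k : ℕ} (A : Fin k → Set X) (J : Set Γ) : Prop :=
  ∀ F : Finset Γ, F.Nonempty → (F : Set Γ) ⊆ J → ∀ ω : F → Fin k,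
    (⋂ s : F, (fun x : X => (s : Γ) • x) ⁻¹' A (ω s)).Nonempty

/-- `q` is a lower density for independence with respect to the family `𝒜` of `k`-tuples: `0 ≤ q`
and every nonempty finite `F ⊆ Γ` has a subset `J` with `|J| ≥ q |F|` which is an independence
set for some member of `𝒜`. -/
def IsIndependenceRate {k : ℕ} (𝒜 : Set (Fin k → Set X)) (q : ℝ) : Prop :=
  0 ≤ q ∧ ∀ F : Finset Γ, F.Nonempty →
    ∃ J : Finset Γ, J ⊆ F ∧ q * (F.card : ℝ) ≤ (J.card : ℝ) ∧
      ∃ A ∈ 𝒜, IsIndependenceSet Γ A (J : Set Γ)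

/-- The independence density of the family `𝒜` of `k`-tuples of subsets of `X`: the largest `q`
satisfying `IsIndependenceRate Γ 𝒜 q`. For `𝒜 ≠ ∅` the supremum is attained
(`isGreatest_independenceDensity`); for `𝒜 = ∅` the value is `0`. -/
def independenceDensity {k : ℕ} (𝒜 : Set (Fin k → Set X)) : ℝ :=
  sSup {q : ℝ | IsIndependenceRate Γ 𝒜 q}

theorem isGreatest_independenceDensity {k : ℕ} {𝒜 : Set (Fin k → Set X)} (h𝒜 : 𝒜.Nonempty) :
    IsGreatest {q : ℝ | IsIndependenceRate Γ 𝒜 q} (independenceDensity Γ 𝒜) := by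
  have hbdd : BddAbove {q : ℝ | IsIndependenceRate Γ 𝒜 q} := by
    refine ⟨1, ?_⟩
    rintro q ⟨-, hq⟩
    obtain ⟨J, hJ, hle, -⟩ := hq {1} (Finset.singleton_nonempty 1)
    have h1 : (J.card : ℝ) ≤ 1 := by exact_mod_cast Finset.card_le_card hJ
    simp only [Finset.card_singleton, Nat.cast_one, mul_one] at hle
    exact hle.trans h1
  have hne : {q : ℝ | IsIndependenceRate Γ 𝒜 q}.Nonempty := by
    obtain ⟨A, hA⟩ := h𝒜
    refine ⟨0, le_rfl, fun F _ => ⟨∅, Finset.empty_subset F, by simp, A, hA, ?_⟩⟩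
    intro F' hF' hsub
    obtain ⟨s, hs⟩ := hF'
    have hmem := hsub (Finset.mem_coe.mpr hs)
    simp at hmem
  refine ⟨⟨?_, ?_⟩, fun q hq => le_csSup hbdd hq⟩
  · obtain ⟨q, hq⟩ := hne
    exact hq.1.trans (le_csSup hbdd hq)
  · intro F hF
    have hFpos : (0 : ℝ) < F.card := by exact_mod_cast hF.card_pos
    classical
    let T : Finset (Finset Γ) :=
      F.powerset.filter (fun J => ∃ A ∈ 𝒜, IsIndependenceSet Γ A (J : Set Γ))
    have hT : T.Nonempty := by
      obtain ⟨q, hq⟩ := hne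
      obtain ⟨J, hJ, -, hJA⟩ := hq.2 F hF
      exact ⟨J, Finset.mem_filter.mpr ⟨Finset.mem_powerset.mpr hJ, hJA⟩⟩
    obtain ⟨J, hJT, hJmax⟩ := T.exists_max_image Finset.card hT
    obtain ⟨hJF, hJA⟩ := Finset.mem_filter.mp hJT
    refine ⟨J, Finset.mem_powerset.mp hJF, ?_, hJA⟩
    rw [← le_div_iff₀ hFpos]
    refine csSup_le hne ?_
    rintro q ⟨-, hq⟩
    obtain ⟨J', hJ', hle, hJA'⟩ := hq F hF
    rw [le_div_iff₀ hFpos]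
    have hcard : J'.card ≤ J.card :=
      hJmax J' (Finset.mem_filter.mpr ⟨Finset.mem_powerset.mpr hJ', hJA'⟩)
    exact hle.trans (by exact_mod_cast hcard)

/-- Every tuple in the family consists of pairwise disjoint sets. -/
def IsPairwiseDisjointFamily {k : ℕ} (𝒜 : Set (Fin k → Set X)) : Prop :=
  ∀ A ∈ 𝒜, ∀ i j : Fin k, i ≠ j → Disjoint (A i) (A j)

/-- Every tuple in the family consists of closed sets. -/
def IsClosedFamily [TopologicalSpace X] {k : ℕ} (𝒜 : Set (Fin k → Set X)) : Prop :=
  ∀ A ∈ 𝒜, ∀ i : Fin k, IsClosed (A i)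

/-- `(x₁, …, x_k)` is an orbit IE-tuple: for all neighborhoods `U_i` of `x_i`, the tuple
`(U₁, …, U_k)` has positive independence density. -/
def IsOrbitIETuple [TopologicalSpace X] {k : ℕ} (x : Fin k → X) : Prop :=
  ∀ U : Fin k → Set X, (∀ i, U i ∈ 𝓝 (x i)) → 0 < independenceDensity Γ {U}

end Independence

/-! ### Naive topological entropy -/

section NaiveEntropy

/-- The minimal cardinality of a finite subcover of the cover `𝒰` of `X`. -/
def minSubcoverCard {X : Type*} (𝒰 : Set (Set X)) : ℕ :=
  sInf {n : ℕ | ∃ 𝒱 : Finset (Set X), (𝒱 : Set (Set X)) ⊆ 𝒰 ∧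
    ⋃₀ (𝒱 : Set (Set X)) = Set.univ ∧ 𝒱.card = n}

/-- The finite open covers of `X`. -/
def IsFiniteOpenCover {X : Type*} [TopologicalSpace X] (𝒰 : Set (Set X)) : Prop :=
  𝒰.Finite ∧ (∀ U ∈ 𝒰, IsOpen U) ∧ ⋃₀ 𝒰 = Set.univ

variable (Γ : Type*) (X : Type*) [Group Γ] [MulAction Γ X]

/-- The join `𝒰^F = ⋁_{s ∈ F} s⁻¹𝒰`, whose members are the sets `⋂_{s ∈ F} s⁻¹ U_s` with
`U_s ∈ 𝒰` for every `s ∈ F`. -/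
def joinCover {Γ X : Type*} [Group Γ] [MulAction Γ X] (𝒰 : Set (Set X)) (F : Finset Γ) :
    Set (Set X) :=
  {W | ∃ U : F → Set X, (∀ s, U s ∈ 𝒰) ∧ W = ⋂ s : F, (fun x : X => (s : Γ) • x) ⁻¹' U s}

/-- The naive entropy of a cover: the infimum of `|F|⁻¹ log N(𝒰^F)` over the nonempty finite
subsets `F` of `Γ`. -/
def naiveEntropyOfCover {X : Type*} [MulAction Γ X] (𝒰 : Set (Set X)) : EReal :=
  ⨅ (F : Finset Γ) (_ : F.Nonempty),
    ((Real.log (minSubcoverCard (joinCover 𝒰 F) : ℝ) / (F.card : ℝ) : ℝ) : EReal)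

/-- The naive topological entropy of the action of `Γ` on `X`: the supremum of the naive
entropies of the finite open covers of `X`. -/
def naiveEntropy [TopologicalSpace X] : EReal :=
  ⨆ (𝒰 : Set (Set X)) (_ : IsFiniteOpenCover 𝒰), naiveEntropyOfCover Γ 𝒰

end NaiveEntropy

/-! ### Pontryagin duals of modules over integral group rings -/

section Dual

/-- The Pontryagin dual of a discrete abelian group `M`: all group homomorphisms `M → ℝ/ℤ`. -/
def DiscreteDual (M : Type*) [AddCommGroup M] : Type _ := M →+ UnitAddCircle

namespace DiscreteDual

variable {M : Type*} [AddCommGroup M]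

instance : AddCommGroup (DiscreteDual M) := inferInstanceAs (AddCommGroup (M →+ UnitAddCircle))

instance : FunLike (DiscreteDual M) M UnitAddCircle :=
  inferInstanceAs (FunLike (M →+ UnitAddCircle) M UnitAddCircle)

/-- The topology of pointwise convergence. -/
instance : TopologicalSpace (DiscreteDual M) :=
  TopologicalSpace.induced (fun (φ : DiscreteDual M) (m : M) => φ m) Pi.topologicalSpace

/-- For a left `ℤΓ`-module `M`, the group `Γ` acts on the dual of `M` by group automorphisms via
`(s φ)(m) = φ(s⁻¹ m)`. -/
instance {Γ : Type*} [Group Γ] [Module (MonoidAlgebra ℤ Γ) M] :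
    DistribMulAction Γ (DiscreteDual M) where
  smul s φ := AddMonoidHom.comp (φ : M →+ UnitAddCircle)
    (DistribSMul.toAddMonoidHom M (MonoidAlgebra.of ℤ Γ s⁻¹))
  one_smul φ := by
    refine AddMonoidHom.ext fun m => ?_
    change (φ : M →+ UnitAddCircle) (MonoidAlgebra.of ℤ Γ 1⁻¹ • m) = (φ : M →+ UnitAddCircle) m
    rw [inv_one, map_one, one_smul]
  mul_smul s t φ := by
    refine AddMonoidHom.ext fun m => ?_
    change (φ : M →+ UnitAddCircle) (MonoidAlgebra.of ℤ Γ (s * t)⁻¹ • m) =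
      (φ : M →+ UnitAddCircle) (MonoidAlgebra.of ℤ Γ t⁻¹ • MonoidAlgebra.of ℤ Γ s⁻¹ • m)
    rw [mul_inv_rev, map_mul, mul_smul]
  smul_zero _ := rfl
  smul_add _ _ _ := rfl

theorem smul_apply {Γ : Type*} [Group Γ] [Module (MonoidAlgebra ℤ Γ) M] (s : Γ)
    (φ : DiscreteDual M) (m : M) : (s • φ) m = φ (MonoidAlgebra.of ℤ Γ s⁻¹ • m) := rfl

theorem add_apply (φ ψ : DiscreteDual M) (m : M) : (φ + ψ) m = φ m + ψ m := rfl

end DiscreteDual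

/-- `X_f`, the Pontryagin dual of the left `ℤΓ`-module `ℤΓ/ℤΓf`. -/
abbrev PrincipalDual {Γ : Type*} [Group Γ] (f : MonoidAlgebra ℤ Γ) : Type _ :=
  DiscreteDual (MonoidAlgebra ℤ Γ ⧸ Submodule.span (MonoidAlgebra ℤ Γ) {f})

/-- The first of the two free generators of `F₂`. -/
abbrev genA : FreeGroup (Fin 2) := FreeGroup.of 0

/-- `X_{a-1}`, the Pontryagin dual of `ℤF₂/ℤF₂(a - 1)`. -/
abbrev XaSubOne : Type :=
  PrincipalDual (MonoidAlgebra.of ℤ (FreeGroup (Fin 2)) genA - 1)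

end Dual

end

/-! ### Topology of the dual -/

namespace DiscreteDual

variable {M : Type*} [AddCommGroup M]

/-! Points of `X_{a-1}` are arbitrary circle-valued functions on the left cosets `g⟨a⟩`, and `s`
carries the coordinate at `s⁻¹h` to the coordinate at `h`. Prescribing the coordinate at `h` to be
`0` or `1/2` along `J` is thus free as soon as the cosets `s⁻¹h⟨a⟩`, `s ∈ J`, are distinct
(`isIndependenceSet_fibrePair`).

Reduced words not starting with `a` or `a⁻¹` lie in distinct right cosets of `⟨a⟩`, so they work for
`h = 1`; left multiplication by `b⁻¹` moves all other words into this set, so those work for `h =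
b`. Every finite `F` has at least half its points of one kind, and the two pairs together have
density at least `1/2`. One finite open cover separates both pairs, so the naive entropy is at least
`(log 2)/2`.

A single coordinate `g` is fixed by the infinite cyclic group `g⟨a⟩g⁻¹`, in which an independence
set for a pair told apart by that coordinate has at most one point. Hence such pairs have density
zero, and distinct points have neighborhoods forming such a pair. -/

instance addMonoidHomClass : AddMonoidHomClass (DiscreteDual M) M UnitAddCircle :=
  inferInstanceAs (AddMonoidHomClass (M →+ UnitAddCircle) M UnitAddCircle)

theorem isClosedEmbedding_coe :
    IsClosedEmbedding (fun (φ : DiscreteDual M) (m : M) => φ m) := by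
  refine ⟨⟨⟨rfl⟩, fun φ ψ h => AddMonoidHom.ext fun m => congrFun h m⟩, ?_⟩
  have hrange : Set.range (fun (φ : DiscreteDual M) (m : M) => φ m) =
      ⋂ (m : M) (n : M), {f : M → UnitAddCircle | f (m + n) = f m + f n} := by
    ext f
    simp only [Set.mem_range, Set.mem_iInter, Set.mem_ofPred_eq]
    refine ⟨?_, fun h => ⟨AddMonoidHom.mk' f h, rfl⟩⟩
    rintro ⟨φ, rfl⟩ m n
    exact AddMonoidHom.map_add φ m n
  rw [hrange]
  exact isClosed_iInter fun m => isClosed_iInter fun n =>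
    isClosed_eq (continuous_apply (m + n)) (.add (continuous_apply m) (continuous_apply n))

theorem continuous_apply_const (m : M) : Continuous fun φ : DiscreteDual M => φ m :=
  (continuous_apply m).comp isClosedEmbedding_coe.continuous

theorem continuous_iff {Y : Type*} [TopologicalSpace Y] {f : Y → DiscreteDual M} :
    Continuous f ↔ ∀ m, Continuous fun y => f y m := by
  rw [isClosedEmbedding_coe.isInducing.continuous_iff, continuous_pi_iff]
  rfl

instance compactSpace : CompactSpace (DiscreteDual M) :=
  haveI : Fact ((0 : ℝ) < 1) := ⟨one_pos⟩
  isClosedEmbedding_coe.compactSpace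

theorem metrizableSpace [Countable M] : TopologicalSpace.MetrizableSpace (DiscreteDual M) :=
  isClosedEmbedding_coe.isEmbedding.metrizableSpace

instance isTopologicalAddGroup : IsTopologicalAddGroup (DiscreteDual M) where
  continuous_add := continuous_iff.2 fun m =>
    ((continuous_apply_const m).comp continuous_fst).add
      ((continuous_apply_const m).comp continuous_snd)
  continuous_neg := continuous_iff.2 fun m => (continuous_apply_const m).neg

instance continuousConstSMul {Γ : Type*} [Group Γ] [Module (MonoidAlgebra ℤ Γ) M] :
    ContinuousConstSMul Γ (DiscreteDual M) where
  continuous_const_smul s := continuous_iff.2 fun m => by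
    simpa only [smul_apply] using continuous_apply_const _

end DiscreteDual

/-! ### Coordinates on `X_f` and on `X_{a-1}` -/

namespace PrincipalDual

variable {Γ : Type*} [Group Γ]

/-- The value of a point of `X_f` at the class of a group element. -/
noncomputable def coord {f : MonoidAlgebra ℤ Γ} (g : Γ) (φ : PrincipalDual f) : UnitAddCircle :=
  φ (Submodule.Quotient.mk (MonoidAlgebra.of ℤ Γ g))

variable {f : MonoidAlgebra ℤ Γ}

theorem continuous_coord (g : Γ) : Continuous (coord g : PrincipalDual f → UnitAddCircle) :=
  DiscreteDual.continuous_apply_const _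

theorem coord_smul (s g : Γ) (φ : PrincipalDual f) : coord g (s • φ) = coord (s⁻¹ * g) φ := by
  rw [coord, DiscreteDual.smul_apply, ← Submodule.Quotient.mk_smul, smul_eq_mul, ← map_mul]
  rfl

/-- The group elements generate `ℤΓ` additively. -/
theorem ext_coord {φ ψ : PrincipalDual f} (h : ∀ g, coord g φ = coord g ψ) : φ = ψ := by
  refine DFunLike.ext _ _ fun m => ?_
  obtain ⟨x, rfl⟩ := Submodule.Quotient.mk_surjective _ m
  induction x using MonoidAlgebra.induction_on with
  | of g => exact h g
  | add x y hx hy =>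
    rw [Submodule.Quotient.mk_add, map_add, map_add, hx, hy]
  | smul r x hx =>
    have e : (Submodule.Quotient.mk (r • x) :
        MonoidAlgebra ℤ Γ ⧸ Submodule.span (MonoidAlgebra ℤ Γ) {f}) =
        r • Submodule.Quotient.mk x := rfl
    rw [e, map_zsmul, map_zsmul, hx]

section SubOne

variable {a : Γ}

theorem coord_mul_right (g : Γ) (φ : PrincipalDual (MonoidAlgebra.of ℤ Γ a - 1)) :
    coord (g * a) φ = coord g φ := by
  unfold coord
  congr 1
  rw [Submodule.Quotient.eq, Submodule.mem_span_singleton]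
  exact ⟨MonoidAlgebra.of ℤ Γ g, by rw [smul_eq_mul, mul_sub, mul_one, ← map_mul]⟩

theorem coord_mul_of_mem_zpowers (g : Γ) {c : Γ} (hc : c ∈ Subgroup.zpowers a)
    (φ : PrincipalDual (MonoidAlgebra.of ℤ Γ a - 1)) : coord (g * c) φ = coord g φ := by
  obtain ⟨n, rfl⟩ := hc
  change coord (g * a ^ n) φ = coord g φ
  induction n with
  | zero => rw [zpow_zero, mul_one]
  | succ n ih => rw [zpow_add_one, ← mul_assoc, coord_mul_right, ih]
  | pred n ih => rw [← ih, ← coord_mul_right (g * _), mul_assoc, zpow_sub_one, inv_mul_cancel_right]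

/-- Every function on `Γ` invariant under right translation by `a` is the coordinate function of
a point of `X_{a-1}`. -/
theorem exists_coord_eq (c : Γ → UnitAddCircle) (hc : ∀ g, c (g * a) = c g) :
    ∃ φ : PrincipalDual (MonoidAlgebra.of ℤ Γ a - 1), ∀ g, coord g φ = c g := by
  let Φ : MonoidAlgebra ℤ Γ →+ UnitAddCircle :=
    (Finsupp.liftAddHom fun g => (zmultiplesHom UnitAddCircle) (c g)).comp
      MonoidAlgebra.coeffAddEquiv.toAddMonoidHom
  have hΦ (g : Γ) : Φ (MonoidAlgebra.of ℤ Γ g) = c g := by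
    simp [Φ]
  -- By additivity it suffices to kill `g(a - 1)`, where the value is `c (g * a) - c g = 0`.
  have hker : (Submodule.span (MonoidAlgebra ℤ Γ)
      {MonoidAlgebra.of ℤ Γ a - 1}).toAddSubgroup ≤ Φ.ker := by
    intro x hx
    obtain ⟨r, rfl⟩ := Submodule.mem_span_singleton.1 hx
    rw [AddMonoidHom.mem_ker, smul_eq_mul]
    clear hx
    induction r using MonoidAlgebra.induction_on with
    | of g => rw [mul_sub, mul_one, ← map_mul, map_sub, hΦ, hΦ, hc, sub_self]
    | add x y hx hy => rw [add_mul, map_add, hx, hy, add_zero]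
    | smul r x hx => rw [smul_mul_assoc, map_zsmul, hx, smul_zero]
  exact ⟨QuotientAddGroup.lift _ Φ hker, fun g => (QuotientAddGroup.lift_mk _ hker _).trans (hΦ g)⟩

end SubOne

end PrincipalDual

/-! ### Countability, for metrizability of the dual -/

instance countable_monoidAlgebra {R M : Type*} [Semiring R] [Countable R] [Countable M] :
    Countable (MonoidAlgebra R M) :=
  MonoidAlgebra.coeffAddEquiv.injective.countable

instance countable_freeGroup {α : Type*} [Countable α] : Countable (FreeGroup α) := by
  classical exact FreeGroup.toWord_injective.countable

/-! ### Reduced words and cosets in free groups -/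

namespace FreeGroup

variable {α : Type*} [DecidableEq α]

theorem of_pow_succ_mul_mem_startsWith {x : α} {g : FreeGroup α}
    (hg : g ∉ startsWith (x, false)) (n : ℕ) : of x ^ (n + 1) * g ∈ startsWith (x, true) := by
  induction n with
  | zero => simpa [of] using startsWith_mk_mul (w := (x, true)) g hg
  | succ n ih =>
    rw [pow_succ', mul_assoc]
    refine startsWith_mk_mul (w := (x, true)) _ fun h => ?_
    simp only [startsWith, Set.mem_ofPred_eq] at ih h
    rw [ih] at h
    simp at h

/-- If `g = xⁿh` with `n > 0`, nothing cancels and `g` starts with `x`; for `n < 0` the roles of `g`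
and `h` are exchanged. -/
theorem eq_of_mul_inv_mem_zpowers {x : α} {g h : FreeGroup α}
    (hg : ∀ ε, g ∉ startsWith (x, ε)) (hh : ∀ ε, h ∉ startsWith (x, ε))
    (hgh : g * h⁻¹ ∈ Subgroup.zpowers (of x)) : g = h := by
  obtain ⟨n, hn⟩ := hgh
  obtain rfl : of x ^ n * h = g := by rw [show of x ^ n = g * h⁻¹ from hn]; group
  rcases n with (_ | n) | n
  · simp
  · have := of_pow_succ_mul_mem_startsWith (hh false) n
    exact absurd (by exact_mod_cast this) (hg true)
  · have := of_pow_succ_mul_mem_startsWith (hg false) n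
    rw [zpow_negSucc, mul_inv_cancel_left] at this
    exact absurd this (hh true)

/-- Nothing cancels, so the product starts with `y⁻¹`. -/
theorem inv_of_mul_notMem_startsWith {x y : α} (hxy : x ≠ y) {g : FreeGroup α} {ε : Bool}
    (hg : g ∈ startsWith (x, ε)) (δ : Bool) : (of y)⁻¹ * g ∉ startsWith (x, δ) := by
  have h : (of y)⁻¹ * g ∈ startsWith (y, false) := by
    refine startsWith_mk_mul (w := (y, false)) g fun h => ?_
    simp only [startsWith, Set.mem_ofPred_eq] at hg h
    rw [hg] at h
    simp_all
  intro h'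
  simp only [startsWith, Set.mem_ofPred_eq] at h h'
  rw [h] at h'
  simp_all

/-- One of the two halves of a finite set has at most one point in each right coset of `⟨x⟩`,
respectively of `y⟨x⟩y⁻¹`. -/
theorem exists_subset_separated {x y : α} (hxy : x ≠ y) (F : Finset (FreeGroup α)) :
    ∃ J ⊆ F, F.card ≤ 2 * J.card ∧ ∃ h ∈ ({1, of y} : Set (FreeGroup α)),
      ∀ s ∈ J, ∀ t ∈ J, h⁻¹ * s * t⁻¹ * h ∈ Subgroup.zpowers (of x) → s = t := by
  classical
  have hcard := F.card_filter_add_card_filter_not (fun g => ∀ ε, g ∉ startsWith (x, ε))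
  rcases le_total (F.filter fun g => ∀ ε, g ∉ startsWith (x, ε)).card
    (F.filter fun g => ¬ ∀ ε, g ∉ startsWith (x, ε)).card with hle | hle
  -- Most words start with `x` or `x⁻¹`; multiplying by `y⁻¹` reduces to the other case.
  · refine ⟨F.filter fun g => ¬ ∀ ε, g ∉ startsWith (x, ε), F.filter_subset _, by omega, of y, by simp,
      fun s hs t ht hst => ?_⟩
    obtain ⟨ε, hs⟩ := not_forall_not.1 (Finset.mem_filter.1 hs).2
    obtain ⟨δ, ht⟩ := not_forall_not.1 (Finset.mem_filter.1 ht).2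
    refine mul_left_cancel (eq_of_mul_inv_mem_zpowers (inv_of_mul_notMem_startsWith hxy hs)
      (inv_of_mul_notMem_startsWith hxy ht) ?_)
    simpa only [mul_inv_rev, inv_inv, ← mul_assoc] using hst
  · refine ⟨F.filter fun g => ∀ ε, g ∉ startsWith (x, ε), F.filter_subset _, by omega, 1, by simp,
      fun s hs t ht hst => ?_⟩
    exact eq_of_mul_inv_mem_zpowers (Finset.mem_filter.1 hs).2 (Finset.mem_filter.1 ht).2
      (by simpa using hst)

end FreeGroup

/-! ### Vanishing of independence density -/

section Independence

variable {Γ X : Type*} [Group Γ] [MulAction Γ X]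

theorem IsIndependenceRate.le_density {k : ℕ} {𝒜 : Set (Fin k → Set X)} (h : 𝒜.Nonempty) {q : ℝ}
    (hq : IsIndependenceRate Γ 𝒜 q) : q ≤ independenceDensity Γ 𝒜 :=
  (isGreatest_independenceDensity Γ h).2 hq

/-- If an infinite order element moves no point of `X` between the fibres of `p`, then a pair of
sets with disjoint images under `p` has density zero. -/
theorem not_independenceDensity_pos {Y : Type*} {p : X → Y} {c : Γ}
    (hinj : Function.Injective fun n : ℕ => c ^ n) (hp : ∀ (n : ℕ) x, p (c ^ n • x) = p x)
    {A : Fin 2 → Set X} (hA : ∀ x ∈ A 0, ∀ y ∈ A 1, p x ≠ p y) :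
    ¬ 0 < independenceDensity Γ {A} := by
  classical
  intro hpos
  -- Among `N` powers of `c`, positive density would give an independence set with more than one
  -- element.
  obtain ⟨N, hN⟩ := exists_nat_gt (1 / independenceDensity Γ {A})
  have hN0 : 0 < N := by
    have := (one_div_pos.2 hpos).trans hN
    exact_mod_cast this
  obtain ⟨J, hJF, hle, B, rfl, hJ⟩ :=
    (isGreatest_independenceDensity Γ (Set.singleton_nonempty A)).1.2
      ((Finset.range N).image fun n => c ^ n) ((Finset.nonempty_range_iff.2 hN0.ne').image _)
  rw [Finset.card_image_of_injective _ hinj, Finset.card_range] at hle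
  have hJ1 : J.card ≤ 1 := by
    refine Finset.card_le_one.2 fun s hs t ht => by_contra fun hst => ?_
    -- This choice sends `s • x` to `A 0` and `t • x` to `A 1`, although `p` agrees on both.
    obtain ⟨x, hx⟩ := hJ J ⟨s, hs⟩ subset_rfl fun u => if u.1 = s then 0 else 1
    have hxs := Set.mem_iInter.1 hx ⟨s, hs⟩
    have hxt := Set.mem_iInter.1 hx ⟨t, ht⟩
    simp only [Set.mem_preimage, if_true, if_neg (Ne.symm hst)] at hxs hxt
    obtain ⟨m, -, rfl⟩ := Finset.mem_image.1 (hJF hs)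
    obtain ⟨n, -, rfl⟩ := Finset.mem_image.1 (hJF ht)
    exact hA _ hxs _ hxt (by rw [hp, hp])
  have hJ1' : (J.card : ℝ) ≤ 1 := by exact_mod_cast hJ1
  rw [div_lt_iff₀ hpos] at hN
  linarith

end Independence

/-! ### Independence and naive entropy -/

section NaiveEntropy

variable {Γ X : Type*} [Group Γ] [MulAction Γ X]

theorem exists_finset_subcover {𝒰 : Set (Set X)} (hfin : 𝒰.Finite) (hcov : ⋃₀ 𝒰 = Set.univ) :
    ∃ 𝒱 : Finset (Set X), (𝒱 : Set (Set X)) ⊆ 𝒰 ∧ ⋃₀ (𝒱 : Set (Set X)) = Set.univ ∧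
      𝒱.card = minSubcoverCard 𝒰 :=
  Nat.sInf_mem (s := {n : ℕ | ∃ 𝒱 : Finset (Set X), (𝒱 : Set (Set X)) ⊆ 𝒰 ∧
    ⋃₀ (𝒱 : Set (Set X)) = Set.univ ∧ 𝒱.card = n})
    ⟨_, hfin.toFinset, by simp, by simpa using hcov, rfl⟩

theorem finite_joinCover {𝒰 : Set (Set X)} (h : 𝒰.Finite) (F : Finset Γ) :
    (joinCover 𝒰 F).Finite := by
  refine ((Set.Finite.pi' fun _ : F => h).image fun U =>
    ⋂ s : F, (fun x : X => (s : Γ) • x) ⁻¹' U s).subset ?_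
  rintro W ⟨U, hU, rfl⟩
  exact ⟨U, hU, rfl⟩

theorem sUnion_joinCover {𝒰 : Set (Set X)} (h : ⋃₀ 𝒰 = Set.univ) (F : Finset Γ) :
    ⋃₀ (joinCover 𝒰 F) = Set.univ := by
  refine Set.eq_univ_of_forall fun x => ?_
  have hx (s : F) : ∃ U ∈ 𝒰, (s : Γ) • x ∈ U := by
    rw [← Set.mem_sUnion, h]; trivial
  choose U hU hxU using hx
  exact ⟨_, ⟨U, hU, rfl⟩, Set.mem_iInter.2 hxU⟩

/-- If `J ⊆ F` is an independence set for a tuple no two of whose sets meet a common member of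
`𝒰`, then `𝒰^F` has no subcover with fewer than `k ^ |J|` members. -/
theorem pow_card_le_minSubcoverCard {k : ℕ} {𝒰 : Set (Set X)} (hfin : 𝒰.Finite)
    (hcov : ⋃₀ 𝒰 = Set.univ) {A : Fin k → Set X}
    (hA : ∀ U ∈ 𝒰, ∀ i j, (U ∩ A i).Nonempty → (U ∩ A j).Nonempty → i = j)
    {F J : Finset Γ} (hJF : J ⊆ F) (hJne : J.Nonempty) (hJ : IsIndependenceSet Γ A (J : Set Γ)) :
    k ^ J.card ≤ minSubcoverCard (joinCover 𝒰 F) := by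
  classical
  obtain ⟨𝒱, h𝒱, h𝒱cov, h𝒱card⟩ :=
    exists_finset_subcover (finite_joinCover hfin F) (sUnion_joinCover hcov F)
  choose x hx using hJ J hJne subset_rfl
  have hmem (ω : J → Fin k) : ∃ W ∈ 𝒱, x ω ∈ W := by
    have := Set.mem_univ (x ω)
    rwa [← h𝒱cov] at this
  choose W hW hxW using hmem
  -- Points with different patterns `ω` need different members of the subcover.
  have hinj : Function.Injective fun ω => (⟨W ω, hW ω⟩ : 𝒱) := by
    intro ω ω' h
    have hWW : W ω = W ω' := congrArg Subtype.val h
    funext s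
    obtain ⟨U, hU, hWU⟩ := h𝒱 (hW ω)
    let s' : F := ⟨s, hJF s.2⟩
    have h1 := hxW ω
    have h2 := hxW ω'
    rw [← hWW] at h2
    rw [hWU] at h1 h2
    exact hA (U s') (hU s') _ _ ⟨_, Set.mem_iInter.1 h1 s', Set.mem_iInter.1 (hx ω) s⟩
      ⟨_, Set.mem_iInter.1 h2 s', Set.mem_iInter.1 (hx ω') s⟩
  simpa [← h𝒱card] using Fintype.card_le_of_injective _ hinj

/-- A family of pairs of positive density all of which are separated by a finite open cover
forces positive naive entropy. -/
theorem naiveEntropy_pos_of_separated [TopologicalSpace X] {𝒜 : Set (Fin 2 → Set X)} {q : ℝ}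
    (hq0 : 0 < q) (hq : IsIndependenceRate Γ 𝒜 q) {𝒰 : Set (Set X)} (h𝒰 : IsFiniteOpenCover 𝒰)
    (hsep : ∀ A ∈ 𝒜, ∀ U ∈ 𝒰, ∀ i j, (U ∩ A i).Nonempty → (U ∩ A j).Nonempty → i = j) :
    0 < naiveEntropy Γ X := by
  have hpos : 0 < q * Real.log 2 := mul_pos hq0 (Real.log_pos one_lt_two)
  refine lt_of_lt_of_le (EReal.coe_pos.2 hpos) (le_iSup₂_of_le 𝒰 h𝒰 (le_iInf₂ fun F hF => ?_))
  obtain ⟨J, hJF, hle, A, hA, hJ⟩ := hq.2 F hF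
  have hFpos : (0 : ℝ) < F.card := by exact_mod_cast hF.card_pos
  have hJne : J.Nonempty := by
    have : (0 : ℝ) < J.card := (mul_pos hq0 hFpos).trans_le hle
    exact Finset.card_pos.1 (by exact_mod_cast this)
  have hN : (2 : ℝ) ^ J.card ≤ minSubcoverCard (joinCover 𝒰 F) := by
    exact_mod_cast pow_card_le_minSubcoverCard h𝒰.1 h𝒰.2.2 (hsep A hA) hJF hJne hJ
  rw [EReal.coe_le_coe_iff, le_div_iff₀ hFpos]
  calc q * Real.log 2 * F.card = q * F.card * Real.log 2 := by ring
    _ ≤ J.card * Real.log 2 := by gcongr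
    _ = Real.log (2 ^ J.card) := (Real.log_pow _ _).symm
    _ ≤ _ := Real.log_le_log (by positivity) hN

end NaiveEntropy

/-! ### Pairs of fibres of a coordinate -/

namespace PrincipalDual

variable {Γ : Type*} [Group Γ] {a : Γ}

/-- The pair of fibres over `0` and `1/2` of the coordinate at `h`. -/
noncomputable def fibrePair (a h : Γ) : Fin 2 → Set (PrincipalDual (MonoidAlgebra.of ℤ Γ a - 1)) :=
  fun i => {φ | coord h φ = ![0, ((1 / 2 : ℝ) : UnitAddCircle)] i}

theorem half_ne_zero : ((1 / 2 : ℝ) : UnitAddCircle) ≠ 0 := by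
  intro h
  obtain ⟨n, hn⟩ := AddCircle.coe_eq_zero_iff (1 : ℝ) |>.1 h
  rw [zsmul_eq_mul, mul_one] at hn
  have h2 : ((2 * n : ℤ) : ℝ) = (1 : ℤ) := by push_cast; linarith
  have := Int.cast_injective h2
  omega

theorem injective_zero_half :
    Function.Injective ![0, ((1 / 2 : ℝ) : UnitAddCircle)] := by
  intro i j hij
  fin_cases i <;> fin_cases j
  · rfl
  · exact absurd hij.symm half_ne_zero
  · exact absurd hij half_ne_zero
  · rfl

theorem isClosed_fibrePair (h : Γ) (i : Fin 2) : IsClosed (fibrePair a h i) :=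
  isClosed_eq (continuous_coord h) continuous_const

theorem disjoint_fibrePair (h : Γ) {i j : Fin 2} (hij : i ≠ j) :
    Disjoint (fibrePair a h i) (fibrePair a h j) :=
  Set.disjoint_left.2 fun _ hi hj => hij (injective_zero_half (hi.symm.trans hj))

theorem isIndependenceSet_fibrePair {h : Γ} {J : Set Γ}
    (hJ : ∀ s ∈ J, ∀ t ∈ J, h⁻¹ * s * t⁻¹ * h ∈ Subgroup.zpowers a → s = t) :
    IsIndependenceSet Γ (fibrePair a h) J := by
  classical
  intro F _ hFJ ω
  -- Take `1/2` on the cosets `s⁻¹h⟨a⟩` with `ω s = 1`, and `0` elsewhere.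
  obtain ⟨φ, hφ⟩ := exists_coord_eq (a := a)
    (fun g => if ∃ s : F, ω s = 1 ∧ h⁻¹ * s * g ∈ Subgroup.zpowers a then
      ((1 / 2 : ℝ) : UnitAddCircle) else 0) (fun g => by
        simp only [← mul_assoc, Subgroup.mul_mem_cancel_right _ (Subgroup.mem_zpowers a)])
  refine ⟨φ, Set.mem_iInter.2 fun t => ?_⟩
  have key : (∃ s : F, ω s = 1 ∧ h⁻¹ * s * ((t : Γ)⁻¹ * h) ∈ Subgroup.zpowers a) ↔ ω t = 1 := by
    refine ⟨?_, fun ht => ⟨t, ht, by simp [one_mem]⟩⟩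
    rintro ⟨s, hs, hst⟩
    obtain rfl : s = t := Subtype.ext (hJ _ (hFJ s.2) _ (hFJ t.2) (by simpa [mul_assoc] using hst))
    exact hs
  change coord h ((t : Γ) • φ) = _
  rw [coord_smul, hφ]
  simp only [key]
  generalize ω t = i
  fin_cases i <;> simp

/-- The action replaces `g` by `g a⁻ⁿ`, which lies in the same left coset of `⟨a⟩`. -/
theorem coord_conj_pow_smul (g : Γ) (n : ℕ) (φ : PrincipalDual (MonoidAlgebra.of ℤ Γ a - 1)) :
    coord g ((g * a * g⁻¹) ^ n • φ) = coord g φ := by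
  rw [coord_smul, conj_pow, ← coord_mul_of_mem_zpowers g
    (inv_mem (pow_mem (Subgroup.mem_zpowers a) n)) φ]
  congr 1
  group

theorem not_independenceDensity_pos_of_coord_ne (ha : ¬ IsOfFinOrder a) (g : Γ)
    {A : Fin 2 → Set (PrincipalDual (MonoidAlgebra.of ℤ Γ a - 1))}
    (hA : ∀ x ∈ A 0, ∀ y ∈ A 1, coord g x ≠ coord g y) : ¬ 0 < independenceDensity Γ {A} :=
  not_independenceDensity_pos (injective_pow_iff_not_isOfFinOrder.2 fun h =>
    ha ((isConj_iff.2 ⟨g, rfl⟩ : IsConj a _).symm.isOfFinOrder h)) (coord_conj_pow_smul g) hA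

theorem not_isOrbitIETuple (ha : ¬ IsOfFinOrder a)
    {x y : PrincipalDual (MonoidAlgebra.of ℤ Γ a - 1)} (hxy : x ≠ y) :
    ¬ IsOrbitIETuple Γ ![x, y] := by
  intro hIE
  obtain ⟨g, hg⟩ : ∃ g, coord g x ≠ coord g y := by
    by_contra! h
    exact hxy (ext_coord h)
  obtain ⟨U, V, hU, hV, hxU, hyV, hUV⟩ := t2_separation hg
  refine not_independenceDensity_pos_of_coord_ne ha g (A := ![coord g ⁻¹' U, coord g ⁻¹' V])
    (fun φ hφ ψ hψ => hUV.ne_of_mem hφ hψ) (hIE _ fun i => ?_)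
  fin_cases i
  · exact (continuous_coord g).continuousAt.preimage_mem_nhds (hU.mem_nhds hxU)
  · exact (continuous_coord g).continuousAt.preimage_mem_nhds (hV.mem_nhds hyV)

/-- The open cover of `X_{a-1}` by the sets of points whose coordinates at `g` and `h` each avoid
one of the values `0` and `1/2`. -/
def avoidingCover (a g h : Γ) : Set (Set (PrincipalDual (MonoidAlgebra.of ℤ Γ a - 1))) :=
  Set.range fun p : Fin 2 × Fin 2 => (fibrePair a g p.1)ᶜ ∩ (fibrePair a h p.2)ᶜ

theorem isFiniteOpenCover_avoidingCover (g h : Γ) : IsFiniteOpenCover (avoidingCover a g h) := by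
  refine ⟨Set.finite_range _, ?_, Set.eq_univ_of_forall fun φ => ?_⟩
  · rintro _ ⟨p, rfl⟩
    exact (isClosed_fibrePair g p.1).isOpen_compl.inter (isClosed_fibrePair h p.2).isOpen_compl
  · have hex (k : Γ) : ∃ i : Fin 2, φ ∉ fibrePair a k i := by
      by_contra! hall
      exact Set.disjoint_left.1 (disjoint_fibrePair k zero_ne_one) (hall 0) (hall 1)
    obtain ⟨i, hi⟩ := hex g
    obtain ⟨j, hj⟩ := hex h
    exact ⟨_, ⟨(i, j), rfl⟩, hi, hj⟩

/-- Each member of the cover misses one of the two sets in either pair. -/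
theorem avoidingCover_separates {g h : Γ} {A : Fin 2 → Set (PrincipalDual _)}
    (hA : A ∈ ({fibrePair a g, fibrePair a h} : Set (Fin 2 → Set _)))
    {U : Set (PrincipalDual (MonoidAlgebra.of ℤ Γ a - 1))} (hU : U ∈ avoidingCover a g h)
    {i j : Fin 2} (hi : (U ∩ A i).Nonempty) (hj : (U ∩ A j).Nonempty) : i = j := by
  have hne : ∃ m : Fin 2, ∀ i, (U ∩ A i).Nonempty → i ≠ m := by
    obtain ⟨⟨p, q⟩, rfl⟩ := hU
    rcases hA with rfl | rfl
    · refine ⟨p, ?_⟩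
      rintro _ ⟨φ, hφ, hφA⟩ rfl
      exact hφ.1 hφA
    · refine ⟨q, ?_⟩
      rintro _ ⟨φ, hφ, hφA⟩ rfl
      exact hφ.2 hφA
  obtain ⟨m, hm⟩ := hne
  have := hm i hi
  have := hm j hj
  omega

end PrincipalDual

/-! ### Conclusion for free groups -/

open PrincipalDual in
/-- Any finite subset of a free group has a subset of at least half its size which is independent
at the coordinate `1` or at the coordinate `y`. -/
theorem isIndependenceRate_fibrePairs {α : Type*} {x y : α} (hxy : x ≠ y) :
    IsIndependenceRate (FreeGroup α) {fibrePair (FreeGroup.of x) (1 : FreeGroup α),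
      fibrePair (FreeGroup.of x) (FreeGroup.of y)} (1 / 2) := by
  classical
  refine ⟨by norm_num, fun F _ => ?_⟩
  obtain ⟨J, hJF, hcard, h, hh, hJ⟩ := FreeGroup.exists_subset_separated hxy F
  refine ⟨J, hJF, ?_, fibrePair _ h, ?_, isIndependenceSet_fibrePair hJ⟩
  · have : (F.card : ℝ) ≤ 2 * J.card := by exact_mod_cast hcard
    linarith
  · rcases hh with rfl | rfl
    · exact Or.inl rfl
    · exact Or.inr rfl

theorem FreeGroup.not_isOfFinOrder_of {α : Type*} (x : α) : ¬ IsOfFinOrder (FreeGroup.of x) := by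
  classical
  rw [isOfFinOrder_iff_pow_eq_one]
  rintro ⟨n, hn, h⟩
  have := congrArg FreeGroup.norm h
  simp at this
  omega

theorem proposition5p2 :
    -- `X_{a-1}` is a compact metrizable abelian group
    (CompactSpace XaSubOne ∧ TopologicalSpace.MetrizableSpace XaSubOne ∧
      IsTopologicalAddGroup XaSubOne) ∧
    -- on which `F₂` acts by continuous automorphisms
    (∀ s : FreeGroup (Fin 2), ∃ e : XaSubOne ≃ₜ+ XaSubOne, ∀ x : XaSubOne, e x = s • x) ∧
    -- with positive naive entropy
    0 < naiveEntropy (FreeGroup (Fin 2)) XaSubOne ∧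
    -- without non-diagonal orbit IE-pairs
    (¬ ∃ x y : XaSubOne, x ≠ y ∧ IsOrbitIETuple (FreeGroup (Fin 2)) ![x, y]) ∧
    -- and positive density of a family of pairs does not pass to any of its members
    (∃ 𝒜 : Set (Fin 2 → Set XaSubOne), 𝒜.Finite ∧ IsPairwiseDisjointFamily 𝒜 ∧
      IsClosedFamily 𝒜 ∧ 0 < independenceDensity (FreeGroup (Fin 2)) 𝒜 ∧
      ∀ A ∈ 𝒜, ¬ 0 < independenceDensity (FreeGroup (Fin 2)) {A}) := by
  have ha : ¬ IsOfFinOrder genA := FreeGroup.not_isOfFinOrder_of 0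
  have hrate := isIndependenceRate_fibrePairs (zero_ne_one (α := Fin 2))
  refine ⟨⟨inferInstance, ?_, inferInstance⟩, fun s => ?_, ?_, ?_, ?_⟩
  · have : Countable (MonoidAlgebra ℤ (FreeGroup (Fin 2)) ⧸ Submodule.span
        (MonoidAlgebra ℤ (FreeGroup (Fin 2))) {MonoidAlgebra.of ℤ (FreeGroup (Fin 2)) genA - 1}) :=
      (Submodule.Quotient.mk_surjective _).countable
    exact DiscreteDual.metrizableSpace
  · exact ⟨{ DistribMulAction.toAddEquiv XaSubOne s, Homeomorph.smul s with }, fun _ => rfl⟩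
  · exact naiveEntropy_pos_of_separated one_half_pos hrate
      (PrincipalDual.isFiniteOpenCover_avoidingCover 1 (FreeGroup.of 1))
      fun _ hA _ hU _ _ => PrincipalDual.avoidingCover_separates hA hU
  · rintro ⟨x, y, hxy, hIE⟩
    exact PrincipalDual.not_isOrbitIETuple ha hxy hIE
  · refine ⟨_, Set.toFinite _, ?_, ?_, one_half_pos.trans_le
      (hrate.le_density (Set.insert_nonempty _ _)), ?_⟩
    · rintro _ (rfl | rfl) i j hij <;> exact PrincipalDual.disjoint_fibrePair _ hij
    · rintro _ (rfl | rfl) i <;> exact PrincipalDual.isClosed_fibrePair _ i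
    · have hA (h : FreeGroup (Fin 2)) :
          ¬ 0 < independenceDensity (FreeGroup (Fin 2)) {PrincipalDual.fibrePair genA h} :=
        PrincipalDual.not_independenceDensity_pos_of_coord_ne ha h fun φ hφ ψ hψ hφψ =>
          zero_ne_one (PrincipalDual.injective_zero_half (hφ.symm.trans (hφψ.trans hψ)))
      rintro _ (rfl | rfl) <;> exact hA _
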